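/- **Model.** In the congested clique with $n$ nodes $u_1,\dots,u_n$, in each synchronous round every node may send a (possibly different) message of $O(\log n)$ bits to every other node; local computation is free. A node *knows* an object after $T$ rounds if the object is a function of its ID, its own input and the messages it has received in these rounds (and of data fixed in advance, such as $n$ and the parameters of the algorithm). All algorithms below are deterministic. **Algorithm ReduceDegree**, with parameter $s\in\mathbb N$, on a graph $G(V,E)$ with $V=\{u_1,\dots,u_n\}$. A fixed node is the coordinator. For a partition of $V$ into components, $C(v)$ is the component of $v$, $d(C)=\max_{w\in C}d_G(w)$, and $I(v)\in[n]$ is the label of $C(v)$ in a fixed labelling rule for components. 1. Each $v$ announces $d_G(v)$ to all its neighbours. 2. Stage 1: each $v$ with a neighbour sends to the coordinator the edge to its neighbour of highest degree (the one with the largest ID among these). The coordinator computes the complete partition (into connected components) with respect to the received edges and sends $(I(v),d(C(v)))$ to each $v$; $v$ announces this pair to its neighbours. 3. Stage 2: each $v$ that has a neighbour outside $C(v)$ sends to the coordinator an edge $(u,v)\in E$ with $C(u)\ne C(v)$ and $d(C(u))$ maximal (ties are broken by a fixed rule). The coordinator computes the complete partition with respect to all edges received in both stages and sends the new pair $(I(v),d(C(v)))$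 to each $v$; $v$ announces it to its neighbours. 4. $v$ is awake if $d(C(v))\ge s$ for the final partition, and asleep otherwise. $E_A$ is the set of edges with both ends awake, $E_B=E\setminus E_A$, and $\mathbb C_A$ is the set of awake components (those containing an awake node). **Lemma.** There is an absolute constant in the $O(\log n)$ bound on the message size such that for every $C$ there are constants $K,P$ with the following property. Let $n\ge 0$, $m\le\lceil\sqrt n\,\rceil$ (so $m$ may be $\sqrt n$ rounded either way), $s\in\mathbb N$, and fix any labelling rule and any tie-breaking rule for ReduceDegree. Then there are a congested clique algorithm and distinct coordinator nodes $c_1,\dots,c_m$ such that for all graphs $G_1(V,E_1),\dots,G_m(V,E_m)$ with $E_1\subseteq E_2\subseteq\dots\subseteq E_m$ and $|E_i|\le C n^{3/2}$ for each $i$, where initially each $u_j$ knows exactly its neighbours in each of $G_1,\dots,G_m$, the algorithm executes ReduceDegree simultaneously on $G_1,\dots,G_m$ within $K$ rounds, in the following framework. There are nodes $\mathrm{proxy}(i,j)\in\{u_1,\dots,u_n\}$ for $i\in[m]$, $j\in[n]$ (they may depend on the input graphs) such that after $K$ rounds * every node knows the whole assignment $\mathrm{proxy}$; * $\mathrm{proxy}(i,j)$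 acts on behalf of $u_j$ in the $i$th instance: it knows the complete record of $u_j$ in the execution of ReduceDegree on $G_i$, that is, the neighbours of $u_j$ in $G_i$, everything that $u_j$ sends and receives in each step, whether $u_j$ is awake, and which edges of $G_i$ at $u_j$ belong to $E_A$ and which to $E_B$; * $c_i$ knows the complete record of the coordinator in the execution on $G_i$: the edges received, the partition computed and the messages sent in each stage, and the partition $\mathbb C_A$; * each node is a proxy of at most $P$ nodes: $|\{k\mid \exists i\in[m]:\ u_j=\mathrm{proxy}(i,k)\}|\le P$ for each $j\in[n]$. -/

import Mathlib

/-! ### The congested clique -/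

namespace CongestedClique

/-- A message of at most `b` bits. The empty list plays the role of "no message". -/
abbrev Message (b : ℕ) : Type := {l : List Bool // l.length ≤ b}

/-- What a node has received: the `t`-th entry of the list maps each node `u` to the message that
`u` sent to the node in round `t + 1`. -/
abbrev Received (n b : ℕ) : Type := List (Fin n → Message b)

/-- A deterministic algorithm for the congested clique with `n` nodes and messages of at most `b`
bits. Local computation is free, so the message that node `v` sends to node `w` in a round is an
arbitrary function of what `v` knows at that time: its ID, its own part of the input, and all
messages that it has received in the earlier rounds. -/
structure Algorithm (n : ℕ) (Input : Type) (b : ℕ) where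
  send : (v : Fin n) → (input : Input) → (received : Received n b) → (w : Fin n) → Message b

/-- `A.received x t v` is the list of everything that node `v` receives in the first `t` rounds
when `A` runs on the joint input `x`, of which each node `u` initially knows only `x u`. -/
def Algorithm.received {n b : ℕ} {Input : Type} (A : Algorithm n Input b) (x : Fin n → Input) :
    ℕ → Fin n → Received n b
  | 0, _ => []
  | t + 1, v => A.received x t v ++ [fun u => A.send u (x u) (A.received x t u) v]

/-- A rule by which every node computes a value of type `α` from its local knowledge. -/
abbrev LocalOutput (n : ℕ) (Input : Type) (b : ℕ) (α : Type) : Type :=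
  (v : Fin n) → (input : Input) → (received : Received n b) → α

/-- The value that node `v` computes by the rule `f` after `t` rounds of `A` on input `x`. -/
def Algorithm.output {n b : ℕ} {Input α : Type} (A : Algorithm n Input b) (x : Fin n → Input)
    (t : ℕ) (f : LocalOutput n Input b α) (v : Fin n) : α :=
  f v (x v) (A.received x t v)

/-- The joint input given by graphs `G 0, …, G (m - 1)` on the `n` nodes: each node knows
its neighbours in each of the graphs. -/
noncomputable def neighbourInput {n m : ℕ} (G : Fin m → SimpleGraph (Fin n)) :
    Fin n → Fin m → Finset (Fin n) :=
  open scoped Classical in fun v i => (G i).neighborFinset v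

end CongestedClique

/-! ### The algorithm ReduceDegree -/

namespace ReduceDegree

/-- The choices that the description of the algorithm leaves open: a labelling of the components
of each graph by IDs in `[n]` (used by the coordinator), and a rule by which a node `v` picks an
element of a nonempty set of equally good candidates in Stage 2. -/
structure Rules (n : ℕ) where
  label : SimpleGraph (Fin n) → Fin n → Fin n
  label_eq_iff : ∀ (F : SimpleGraph (Fin n)) (u v : Fin n), label F u = label F v ↔ F.Reachable u v
  pick : Fin n → Finset (Fin n) → Fin n
  pick_mem : ∀ (v : Fin n) (S : Finset (Fin n)), S.Nonempty → pick v S ∈ S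

variable {n : ℕ}

open scoped Classical in
/-- The vertex set of the connected component of `v` in `F`. -/
noncomputable def component (F : SimpleGraph (Fin n)) (v : Fin n) : Finset (Fin n) :=
  {w | F.Reachable v w}

open scoped Classical in
/-- The complete partition with respect to the edges of `F`. -/
noncomputable def completePartition (F : SimpleGraph (Fin n)) : Finset (Finset (Fin n)) :=
  Finset.univ.image (component F)

open scoped Classical in
/-- The degree of the component of `v` in `F`: the largest degree in `G` of one of its elements. -/
noncomputable def componentDegree (G F : SimpleGraph (Fin n)) (v : Fin n) : ℕ :=
  (component F v).sup fun w => G.degree w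

/-- The graph of the edges sent to the coordinator, if `v` sends `(u, v)` for `e v = some u` and
sends no edge for `e v = none`. -/
def sentGraph (e : Fin n → Option (Fin n)) : SimpleGraph (Fin n) :=
  SimpleGraph.fromRel fun v u => e v = some u

open scoped Classical in
/-- The neighbours of `v` of highest degree. -/
noncomputable def candidates1 (G : SimpleGraph (Fin n)) (v : Fin n) : Finset (Fin n) :=
  {u ∈ G.neighborFinset v | ∀ t ∈ G.neighborFinset v, G.degree t ≤ G.degree u}

open scoped Classical in
/-- Stage 1: `v` sends the edge to the node with the largest ID among its neighbours of highest
degree (and nothing if it has no neighbours). -/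
noncomputable def edge1 (G : SimpleGraph (Fin n)) (v : Fin n) : Option (Fin n) :=
  if h : (candidates1 G v).Nonempty then some ((candidates1 G v).max' h) else none

/-- The graph of the edges that the coordinator has received in Stage 1. -/
noncomputable def graph1 (G : SimpleGraph (Fin n)) : SimpleGraph (Fin n) := sentGraph (edge1 G)

open scoped Classical in
/-- The neighbours of `v` that lie in a highest degree component incident to `v`, with respect to
the partition of Stage 1. -/
noncomputable def candidates2 (G : SimpleGraph (Fin n)) (v : Fin n) : Finset (Fin n) :=
  {u ∈ G.neighborFinset v | ¬ (graph1 G).Reachable v u ∧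
    ∀ t ∈ G.neighborFinset v, ¬ (graph1 G).Reachable v t →
      componentDegree G (graph1 G) t ≤ componentDegree G (graph1 G) u}

open scoped Classical in
/-- Stage 2: `v` sends an edge to a highest degree component incident to `v` (and nothing if no
other component is incident to `v`). -/
noncomputable def edge2 (R : Rules n) (G : SimpleGraph (Fin n)) (v : Fin n) : Option (Fin n) :=
  if (candidates2 G v).Nonempty then some (R.pick v (candidates2 G v)) else none

/-- The graph of the edges that the coordinator has received in both stages. -/
noncomputable def graph2 (R : Rules n) (G : SimpleGraph (Fin n)) : SimpleGraph (Fin n) :=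
  graph1 G ⊔ sentGraph (edge2 R G)

/-- The message `(I(v), d(C(v)))` that the coordinator sends to `v` when it knows the edges
of `F`. -/
noncomputable def componentMessage (R : Rules n) (G F : SimpleGraph (Fin n)) (v : Fin n) :
    Fin n × ℕ :=
  (R.label F v, componentDegree G F v)

/-- A node is awake if its final component has degree at least `s`, and asleep otherwise. -/
def Awake (R : Rules n) (s : ℕ) (G : SimpleGraph (Fin n)) (v : Fin n) : Prop :=
  s ≤ componentDegree G (graph2 R G) v

/-- The graph `G_A` of the edges between two awake nodes. -/
def graphA (R : Rules n) (s : ℕ) (G : SimpleGraph (Fin n)) : SimpleGraph (Fin n) where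
  Adj u v := G.Adj u v ∧ Awake R s G u ∧ Awake R s G v
  symm := ⟨fun _ _ h => ⟨h.1.symm, h.2.2, h.2.1⟩⟩
  loopless := ⟨fun _ h => h.1.ne rfl⟩

/-- The graph `G_B` of the edges with an asleep end. -/
def graphB (R : Rules n) (s : ℕ) (G : SimpleGraph (Fin n)) : SimpleGraph (Fin n) where
  Adj u v := G.Adj u v ∧ (¬ Awake R s G u ∨ ¬ Awake R s G v)
  symm := ⟨fun _ _ h => ⟨h.1.symm, h.2.symm⟩⟩
  loopless := ⟨fun _ h => h.1.ne rfl⟩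

open scoped Classical in
/-- The messages that `v` receives when each node `u` announces `msg u` to its neighbours. -/
noncomputable def heard {α : Type} (G : SimpleGraph (Fin n)) (msg : Fin n → α) (v : Fin n) :
    Fin n → Option α :=
  fun u => if G.Adj v u then some (msg u) else none

/-- The record of a complete execution of the algorithm at one node: its input, all that it sends
and receives in the successive steps, and its results. -/
structure NodeRecord (n : ℕ) where
  neighbours : Finset (Fin n)
  heardDegrees : Fin n → Option ℕ
  sentEdge1 : Option (Fin n)
  component1 : Fin n × ℕ
  heardComponents1 : Fin n → Option (Fin n × ℕ)
  sentEdge2 : Option (Fin n)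
  component2 : Fin n × ℕ
  heardComponents2 : Fin n → Option (Fin n × ℕ)
  awake : Bool
  neighboursA : Finset (Fin n)
  neighboursB : Finset (Fin n)

open scoped Classical in
/-- The record of node `v` in the execution of ReduceDegree with parameter `s` on `G`. -/
noncomputable def nodeRecord (R : Rules n) (s : ℕ) (G : SimpleGraph (Fin n)) (v : Fin n) :
    NodeRecord n where
  neighbours := G.neighborFinset v
  heardDegrees := heard G (fun u => G.degree u) v
  sentEdge1 := edge1 G v
  component1 := componentMessage R G (graph1 G) v
  heardComponents1 := heard G (componentMessage R G (graph1 G)) v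
  sentEdge2 := edge2 R G v
  component2 := componentMessage R G (graph2 R G) v
  heardComponents2 := heard G (componentMessage R G (graph2 R G)) v
  awake := decide (Awake R s G v)
  neighboursA := (graphA R s G).neighborFinset v
  neighboursB := (graphB R s G).neighborFinset v

/-- The record of a complete execution of the algorithm at the coordinator: in each stage the edge
received from each node, the partition computed, and the message sent to each node; finally the
partition `ℂ_A` into awake components. -/
structure CoordinatorRecord (n : ℕ) where
  edges1 : Fin n → Option (Fin n)
  partition1 : Finset (Finset (Fin n))
  messages1 : Fin n → Fin n × ℕ
  edges2 : Fin n → Option (Fin n)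
  partition2 : Finset (Finset (Fin n))
  messages2 : Fin n → Fin n × ℕ
  awakeComponents : Finset (Finset (Fin n))

open scoped Classical in
/-- The record of the coordinator in the execution of ReduceDegree with parameter `s` on `G`. -/
noncomputable def coordinatorRecord (R : Rules n) (s : ℕ) (G : SimpleGraph (Fin n)) :
    CoordinatorRecord n where
  edges1 := edge1 G
  partition1 := completePartition (graph1 G)
  messages1 := componentMessage R G (graph1 G)
  edges2 := edge2 R G
  partition2 := completePartition (graph2 R G)
  messages2 := componentMessage R G (graph2 R G)
  awakeComponents := {C ∈ completePartition (graph2 R G) | ∃ v ∈ C, Awake R s G v}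

end ReduceDegree

/-! ### Knowledge as indistinguishability, and single rounds of communication. -/

namespace CongestedClique

variable {n b t : ℕ} {Input Ω : Type} {inp : Ω → Fin n → Input} {E : Fin n → Ω → Ω → Prop}

/-! Local computation is free, so knowledge can be treated as a relation: a node knows whatever
agrees on all inputs that it cannot tell apart. `Learnable` tracks this relation round by round, and
`exists_localOutput` turns it back into output rules. What remains is to move the right data in O(1)
rounds.

Data travel along patterns that all nodes know in advance. If each node sends and receives at most L
* n messages, a greedy edge colouring of the bipartite multigraph of sources and destinations uses 2
* L * n colours. A colour names a phase and an intermediate node, so two rounds per phase suffice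
(`Learnable.route`).

The patterns depend only on the degrees d in the last, largest graph, announced in one round. Work
for u_j in all m instances is about m * d(u_j), possibly n^(3/2). So u_j is split among about
d(u_j)/√n + 1 proxies, each with O(n) work; as the degrees sum to O(n^(3/2)), there are O(n) such
slots, O(1) per node (`exists_proxy`). Dually, the nodes of residue i mod m all replicate the
coordinator of instance i and share its queries evenly (`exists_server`).

Since the graphs increase, one number per pair of nodes conveys all adjacencies to the proxies. Each
proxy asks the servers once about the closed neighbourhood of its node in the last graph, and the
same queries are answered with degrees, Stage 1 messages and Stage 2 messages; in between, the
servers collect the selected edges. By `nodeRecord_congr` and `coordinatorRecord_congr` these data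
determine all records. -/

theorem Algorithm.length_received (A : Algorithm n Input b) (x : Fin n → Input) (t : ℕ)
    (v : Fin n) : (A.received x t v).length = t := by
  induction t with
  | zero => rfl
  | succ t ih => simp [Algorithm.received, ih]

/-- Some algorithm gives the nodes within `t` rounds enough knowledge to distinguish, at each
node `v`, any two instances `ω`, `ω'` that are not related by `E v`. -/
def Learnable (b : ℕ) (inp : Ω → Fin n → Input) (t : ℕ) (E : Fin n → Ω → Ω → Prop) : Prop :=
  ∃ A : Algorithm n Input b, ∀ v ω ω', inp ω v = inp ω' v →
    A.received (inp ω) t v = A.received (inp ω') t v → E v ω ω'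

theorem Learnable.mono {E' : Fin n → Ω → Ω → Prop} (h : Learnable b inp t E)
    (hE : ∀ v ω ω', E v ω ω' → E' v ω ω') : Learnable b inp t E' := by
  obtain ⟨A, hA⟩ := h
  exact ⟨A, fun v ω ω' h₁ h₂ => hE _ _ _ (hA v ω ω' h₁ h₂)⟩

theorem learnable_input (b : ℕ) (inp : Ω → Fin n → Input) :
    Learnable b inp 0 (fun v ω ω' => inp ω v = inp ω' v) :=
  ⟨⟨fun _ _ _ _ => ⟨[], by simp⟩⟩, fun _ _ _ h _ => h⟩

open scoped Classical in
/-- One more round, in which `u` sends `msg ω u v` to `v`. -/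
theorem Learnable.round (h : Learnable b inp t E) (msg : Ω → Fin n → Fin n → Message b)
    (hmsg : ∀ u ω ω', E u ω ω' → msg ω u = msg ω' u) :
    Learnable b inp (t + 1) (fun v ω ω' => E v ω ω' ∧ ∀ u, msg ω u v = msg ω' u v) := by
  obtain ⟨A, hA⟩ := h
  -- The length of the received list tells the round. In the new round, a node picks any instance
  -- consistent with what it has seen and sends the message of that instance; `hmsg` makes the
  -- choice irrelevant.
  let A' : Algorithm n Input b := ⟨fun v x rec w =>
    if rec.length < t then A.send v x rec w
    else if h : ∃ ω, inp ω v = x ∧ A.received (inp ω) t v = rec then msg h.choose v w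
    else ⟨[], by simp⟩⟩
  have agree : ∀ (x : Fin n → Input) (r : ℕ), r ≤ t → ∀ v, A'.received x r v = A.received x r v := by
    intro x r
    induction r with
    | zero => intros; rfl
    | succ r ih =>
      intro hr v
      simp only [Algorithm.received]
      rw [ih (by omega) v]
      congr 2
      funext u
      rw [ih (by omega) u]
      simp only [A']
      rw [if_pos (by rw [A.length_received]; omega)]
  have last : ∀ ω v, A'.received (inp ω) (t + 1) v =
      A.received (inp ω) t v ++ [fun u => msg ω u v] := by
    intro ω v
    simp only [Algorithm.received]
    rw [agree _ t le_rfl v]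
    congr 2
    funext u
    rw [agree _ t le_rfl u]
    have hex : ∃ ω', inp ω' u = inp ω u ∧ A.received (inp ω') t u = A.received (inp ω) t u :=
      ⟨ω, rfl, rfl⟩
    simp only [A']
    rw [if_neg (by rw [A.length_received]; omega), dif_pos hex,
      hmsg u _ ω (hA u _ ω hex.choose_spec.1 hex.choose_spec.2)]
  refine ⟨A', fun v ω ω' h₁ h₂ => ?_⟩
  rw [last, last] at h₂
  obtain ⟨h₃, h₄⟩ := List.append_inj' h₂ rfl
  exact ⟨hA v ω ω' h₁ h₃, fun u => congrFun (List.singleton_injective h₄) u⟩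

/-- What is determined by the knowledge of the nodes can be computed by a local rule. -/
theorem exists_localOutput {α : Type} [Nonempty α] (A : Algorithm n Input b)
    (inp : Ω → Fin n → Input) (t : ℕ) (F : Ω → Fin n → α)
    (hF : ∀ v ω ω', inp ω v = inp ω' v →
      A.received (inp ω) t v = A.received (inp ω') t v → F ω v = F ω' v) :
    ∃ f : LocalOutput n Input b α, ∀ ω v, A.output (inp ω) t f v = F ω v := by
  classical
  refine ⟨fun v x rec => if h : ∃ ω, inp ω v = x ∧ A.received (inp ω) t v = rec then
    F h.choose v else Classical.arbitrary α, fun ω v => ?_⟩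
  have hex : ∃ ω', inp ω' v = inp ω v ∧ A.received (inp ω') t v = A.received (inp ω) t v :=
    ⟨ω, rfl, rfl⟩
  simp only [Algorithm.output]
  rw [dif_pos hex]
  exact hF v _ _ hex.choose_spec.1 hex.choose_spec.2

/-- Counting bit vectors of length exactly `b` suffices; values outside `F` are sent to the empty
message. This lets later rounds exchange elements of arbitrary finite sets. -/
theorem exists_encoding {β : Type} (F : Finset β) (hF : F.card ≤ 2 ^ b) :
    ∃ enc : β → Message b, Set.InjOn enc F := by
  classical
  have hcard : Fintype.card F ≤ Fintype.card (List.Vector Bool b) := by simpa using hF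
  obtain ⟨e⟩ := Function.Embedding.nonempty_of_card_le hcard
  refine ⟨fun x => if h : x ∈ F then ⟨(e ⟨x, h⟩).1, (e ⟨x, h⟩).2.le⟩ else ⟨[], by simp⟩, ?_⟩
  intro x hx y hy hxy
  have hx' : x ∈ F := hx
  have hy' : y ∈ F := hy
  simp only [hx', hy', dif_pos, Subtype.mk.injEq] at hxy
  simpa using e.injective (Subtype.ext hxy)

/-- One round in which the nodes exchange elements of a set `F` of at most `2 ^ b` elements. -/
theorem Learnable.exchange {β : Type} (h : Learnable b inp t E) (F : Finset β)
    (hF : F.card ≤ 2 ^ b) (val : Ω → Fin n → Fin n → β) (hval : ∀ ω u v, val ω u v ∈ F)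
    (hknow : ∀ u ω ω', E u ω ω' → val ω u = val ω' u) :
    Learnable b inp (t + 1) (fun v ω ω' => E v ω ω' ∧ ∀ u, val ω u v = val ω' u v) := by
  obtain ⟨enc, henc⟩ := exists_encoding F hF
  refine (h.round (fun ω u v => enc (val ω u v)) fun u ω ω' hE => ?_).mono ?_
  · simp only [hknow u ω ω' hE]
  · exact fun v ω ω' hE => ⟨hE.1, fun u => henc (hval _ _ _) (hval _ _ _) (hE.2 u)⟩

/-! ### Routing with commonly known sources and destinations. -/

section Routing

variable {κ M β : Type} {key : Ω → κ}

/-- Delivery of messages in one round if no two messages have the same source and destination. -/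
theorem Learnable.direct (h : Learnable b inp t E)
    (hkey : ∀ v ω ω', E v ω ω' → key ω = key ω')
    (S : κ → Finset M) (src dst : κ → M → Fin n) (pay : Ω → M → β) (F : Finset β)
    (hF : F.card ≤ 2 ^ b) (hpay : ∀ ω μ, pay ω μ ∈ F)
    (hknow : ∀ ω ω', ∀ μ ∈ S (key ω), E (src (key ω) μ) ω ω' → pay ω μ = pay ω' μ)
    (hinj : ∀ ω, ∀ μ ∈ S (key ω), ∀ ν ∈ S (key ω), src (key ω) μ = src (key ω) ν →
      dst (key ω) μ = dst (key ω) ν → μ = ν) :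
    Learnable b inp (t + 1) (fun v ω ω' => E v ω ω' ∧
      ∀ μ ∈ S (key ω), dst (key ω) μ = v → pay ω μ = pay ω' μ) := by
  classical
  by_cases hFe : F.Nonempty
  swap
  · refine (h.round (fun _ _ _ => ⟨[], by simp⟩) fun _ _ _ _ => rfl).mono ?_
    exact fun v ω ω' hE => ⟨hE.1, fun μ _ _ => absurd ⟨_, hpay ω μ⟩ hFe⟩
  obtain ⟨x₀, hx₀⟩ := hFe
  -- Both ends know the key, hence agree on which message, if any, uses the link from `u` to `v`;
  -- unused links carry the default `x₀`.
  let idx : κ → Fin n → Fin n → Option M := fun k u v =>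
    if h : ∃ μ ∈ S k, src k μ = u ∧ dst k μ = v then some h.choose else none
  have idx_spec : ∀ k u v μ, idx k u v = some μ → μ ∈ S k ∧ src k μ = u ∧ dst k μ = v := by
    intro k u v μ hμ
    simp only [idx] at hμ
    split_ifs at hμ with hex
    rw [← Option.some.inj hμ]
    exact hex.choose_spec
  have idx_eq : ∀ ω, ∀ μ ∈ S (key ω),
      idx (key ω) (src (key ω) μ) (dst (key ω) μ) = some μ := by
    intro ω μ hμ
    have hex : ∃ ν ∈ S (key ω), src (key ω) ν = src (key ω) μ ∧ dst (key ω) ν = dst (key ω) μ :=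
      ⟨μ, hμ, rfl, rfl⟩
    simp only [idx]
    rw [dif_pos hex]
    congr 1
    exact hinj ω _ hex.choose_spec.1 _ hμ hex.choose_spec.2.1 hex.choose_spec.2.2
  refine (h.exchange F hF (fun ω u v => ((idx (key ω) u v).map (pay ω)).getD x₀) ?_ ?_).mono ?_
  · intro ω u v
    cases idx (key ω) u v with
    | none => simpa using hx₀
    | some μ => simpa using hpay ω μ
  · intro u ω ω' hE
    funext v
    rw [← hkey u ω ω' hE]
    cases hi : idx (key ω) u v with
    | none => rfl
    | some μ =>
      obtain ⟨h₁, rfl, -⟩ := idx_spec _ _ _ _ hi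
      simpa using hknow ω ω' μ h₁ hE
  · rintro v ω ω' ⟨hE, hval⟩
    refine ⟨hE, ?_⟩
    rintro μ hμ rfl
    have := hval (src (key ω) μ)
    rw [← hkey _ ω ω' hE, idx_eq ω μ hμ] at this
    simpa using this

/-- Delivery of messages in two rounds via intermediate nodes. -/
theorem Learnable.relay (h : Learnable b inp t E)
    (hkey : ∀ v ω ω', E v ω ω' → key ω = key ω')
    (S : κ → Finset M) (src mid dst : κ → M → Fin n) (pay : Ω → M → β) (F : Finset β)
    (hF : F.card ≤ 2 ^ b) (hpay : ∀ ω μ, pay ω μ ∈ F)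
    (hknow : ∀ ω ω', ∀ μ ∈ S (key ω), E (src (key ω) μ) ω ω' → pay ω μ = pay ω' μ)
    (hinj : ∀ ω, ∀ μ ∈ S (key ω), ∀ ν ∈ S (key ω), mid (key ω) μ = mid (key ω) ν →
      (src (key ω) μ = src (key ω) ν ∨ dst (key ω) μ = dst (key ω) ν) → μ = ν) :
    Learnable b inp (t + 2) (fun v ω ω' => E v ω ω' ∧
      ∀ μ ∈ S (key ω), dst (key ω) μ = v → pay ω μ = pay ω' μ) := by
  have h₁ := h.direct hkey S src mid pay F hF hpay hknow
    fun ω μ hμ ν hν hs hm => hinj ω μ hμ ν hν hm (.inl hs)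
  have h₂ := h₁.direct (fun v ω ω' hE => hkey v ω ω' hE.1) S mid dst pay F hF hpay
    (fun ω ω' μ hμ hE => hE.2 μ hμ rfl)
    fun ω μ hμ ν hν hm hd => hinj ω μ hμ ν hν hm (.inr hd)
  exact h₂.mono fun v ω ω' hE => ⟨hE.1.1, hE.2⟩

/-- Greedy edge colouring of a bipartite multigraph of maximum degree at most `L` by `2 * L`
colours. -/
theorem exists_edgeColouring {V Q : Type} [DecidableEq V] [Fintype Q] [Nonempty Q] (S : Finset M)
    (src dst : M → V) (L : ℕ) (hQ : 2 * L ≤ Fintype.card Q)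
    (hsrc : ∀ v, {μ ∈ S | src μ = v}.card ≤ L) (hdst : ∀ v, {μ ∈ S | dst μ = v}.card ≤ L) :
    ∃ col : M → Q, ∀ μ ∈ S, ∀ ν ∈ S, col μ = col ν → (src μ = src ν ∨ dst μ = dst ν) → μ = ν := by
  classical
  induction S using Finset.induction_on with
  | empty => exact ⟨fun _ => Classical.arbitrary Q, by simp⟩
  | insert a S ha ih =>
    have hs : ∀ v, {μ ∈ S | src μ = v}.card ≤ L := fun v =>
      (Finset.card_le_card (Finset.filter_subset_filter _ (Finset.subset_insert a S))).trans (hsrc v)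
    have hd : ∀ v, {μ ∈ S | dst μ = v}.card ≤ L := fun v =>
      (Finset.card_le_card (Finset.filter_subset_filter _ (Finset.subset_insert a S))).trans (hdst v)
    obtain ⟨col, hcol⟩ := ih hs hd
    have hs' : {μ ∈ S | src μ = src a}.card + 1 ≤ L := by
      have := hsrc (src a)
      rwa [Finset.filter_insert, if_pos rfl, Finset.card_insert_of_notMem (by simp [ha])] at this
    have hd' : {μ ∈ S | dst μ = dst a}.card + 1 ≤ L := by
      have := hdst (dst a)
      rwa [Finset.filter_insert, if_pos rfl, Finset.card_insert_of_notMem (by simp [ha])] at this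
    -- The colours forbidden for `a`: at most `L - 1` at its source and `L - 1` at its destination,
    -- fewer than `2 * L`.
    let N := ({μ ∈ S | src μ = src a} ∪ {μ ∈ S | dst μ = dst a}).image col
    have hN : N.card < Fintype.card Q := by
      have := (Finset.card_image_le (f := col)
        (s := {μ ∈ S | src μ = src a} ∪ {μ ∈ S | dst μ = dst a})).trans (Finset.card_union_le _ _)
      change N.card ≤ _ at this
      omega
    obtain ⟨q, hq⟩ : ∃ q, q ∉ N := by
      by_contra! hall
      rw [Finset.eq_univ_iff_forall.2 hall] at hN
      simp at hN
    have hfree : ∀ μ ∈ S, (src μ = src a ∨ dst μ = dst a) → col μ ≠ q := by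
      rintro μ hμ hor rfl
      exact hq (Finset.mem_image_of_mem _ (by simpa [hμ] using hor))
    have hne : ∀ μ ∈ S, μ ≠ a := fun μ hμ h => ha (h ▸ hμ)
    refine ⟨Function.update col a q, fun μ hμ ν hν hc hor => ?_⟩
    rcases Finset.mem_insert.1 hμ with rfl | hμS <;> rcases Finset.mem_insert.1 hν with rfl | hνS
    · rfl
    · rw [Function.update_self, Function.update_of_ne (hne ν hνS)] at hc
      exact absurd hc.symm (hfree ν hνS (hor.imp Eq.symm Eq.symm))
    · rw [Function.update_self, Function.update_of_ne (hne μ hμS)] at hc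
      exact absurd hc (hfree μ hμS hor)
    · rw [Function.update_of_ne (hne ν hνS), Function.update_of_ne (hne μ hμS)] at hc
      exact hcol μ hμS ν hνS hc hor

/-- Routing: if all nodes know the sources and the destinations of all messages, and each node is
the source and the destination of at most `L * n` messages, then `4 * L` rounds suffice. -/
theorem Learnable.route (h : Learnable b inp t E)
    (hkey : ∀ v ω ω', E v ω ω' → key ω = key ω') (L : ℕ)
    (S : κ → Finset M) (src dst : κ → M → Fin n) (pay : Ω → M → β) (F : Finset β)
    (hF : F.card ≤ 2 ^ b) (hpay : ∀ ω μ, pay ω μ ∈ F)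
    (hknow : ∀ ω ω', ∀ μ ∈ S (key ω), E (src (key ω) μ) ω ω' → pay ω μ = pay ω' μ)
    (hsrc : ∀ ω v, {μ ∈ S (key ω) | src (key ω) μ = v}.card ≤ L * n)
    (hdst : ∀ ω v, {μ ∈ S (key ω) | dst (key ω) μ = v}.card ≤ L * n) :
    Learnable b inp (t + 4 * L) (fun v ω ω' => E v ω ω' ∧
      ∀ μ ∈ S (key ω), dst (key ω) μ = v → pay ω μ = pay ω' μ) := by
  classical
  -- The colouring is chosen as a function of the key alone, so all nodes use the same one. The
  -- `Option` provides a dummy colour when there may be no node at all.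
  have hcol : ∀ k : κ, ∃ col : M → ℕ × Option (Fin n),
      (∃ ω, key ω = k) → (∀ μ ∈ S k, (col μ).1 < 2 * L ∧ (col μ).2.isSome) ∧
      ∀ μ ∈ S k, ∀ ν ∈ S k, col μ = col ν →
        (src k μ = src k ν ∨ dst k μ = dst k ν) → μ = ν := by
    intro k
    by_cases hk : ∃ ω, key ω = k
    swap
    · exact ⟨fun _ => (0, none), fun h => absurd h hk⟩
    obtain ⟨ω, rfl⟩ := hk
    by_cases hS : (S (key ω)).Nonempty
    swap
    · rw [Finset.not_nonempty_iff_eq_empty] at hS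
      exact ⟨fun _ => (0, none), fun _ => by simp [hS]⟩
    obtain ⟨μ₀, hμ₀⟩ := hS
    have hpos : 0 < L := by
      rcases Nat.eq_zero_or_pos L with rfl | hL
      · have := hsrc ω (src (key ω) μ₀)
        rw [Nat.zero_mul, Nat.le_zero, Finset.card_eq_zero] at this
        exact absurd (this ▸ Finset.mem_filter.2 ⟨hμ₀, rfl⟩) (Finset.notMem_empty μ₀)
      · exact hL
    have : Nonempty (Fin (2 * L) × Fin n) := ⟨⟨0, by omega⟩, src (key ω) μ₀⟩
    obtain ⟨col, hc⟩ := exists_edgeColouring (Q := Fin (2 * L) × Fin n) (S (key ω)) (src (key ω))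
      (dst (key ω)) (L * n) (by simp [Nat.mul_assoc]) (hsrc ω) (hdst ω)
    refine ⟨fun μ => ((col μ).1, some (col μ).2), fun _ => ⟨fun μ _ => ⟨(col μ).1.2, rfl⟩, ?_⟩⟩
    intro μ hμ ν hν hμν hor
    simp only [Prod.mk.injEq, Option.some.injEq] at hμν
    exact hc μ hμ ν hν (Prod.ext (Fin.ext hμν.1) hμν.2) hor
  choose col hcol using hcol
  -- Phase `r` relays the messages whose colour has first component `r`; within a phase, messages
  -- sharing a source or a destination have distinct intermediate nodes.
  have step : ∀ r ≤ 2 * L, Learnable b inp (t + 2 * r) (fun v ω ω' => E v ω ω' ∧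
      ∀ μ ∈ S (key ω), (col (key ω) μ).1 < r → dst (key ω) μ = v → pay ω μ = pay ω' μ) := by
    intro r hr
    induction r with
    | zero => exact h.mono fun v ω ω' hE => ⟨hE, fun _ _ h0 => absurd h0 (Nat.not_lt_zero _)⟩
    | succ r ih =>
      have h₂ := (ih (by omega)).relay (fun v ω ω' hE => hkey v ω ω' hE.1)
        (fun k => {μ ∈ S k | (col k μ).1 = r}) src
        (fun k μ => (col k μ).2.getD (src k μ)) dst pay F hF hpay
        (fun ω ω' μ hμ hE => hknow ω ω' μ (Finset.mem_filter.1 hμ).1 hE.1) ?_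
      · refine h₂.mono ?_
        rintro v ω ω' ⟨⟨hE, h₃⟩, h₄⟩
        refine ⟨hE, fun μ hμ hlt hv => ?_⟩
        rcases Nat.lt_succ_iff_lt_or_eq.1 hlt with hlt | heq
        · exact h₃ μ hμ hlt hv
        · exact h₄ μ (Finset.mem_filter.2 ⟨hμ, heq⟩) hv
      · intro ω μ hμ ν hν hmid hor
        obtain ⟨hμ, hμr⟩ := Finset.mem_filter.1 hμ
        obtain ⟨hν, hνr⟩ := Finset.mem_filter.1 hν
        obtain ⟨hlt, hproper⟩ := hcol (key ω) ⟨ω, rfl⟩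
        refine hproper μ hμ ν hν (Prod.ext (hμr.trans hνr.symm) ?_) hor
        obtain ⟨x, hx⟩ := Option.isSome_iff_exists.1 (hlt μ hμ).2
        obtain ⟨y, hy⟩ := Option.isSome_iff_exists.1 (hlt ν hν).2
        simp only [hx, hy, Option.getD_some] at hmid
        rw [hx, hy, hmid]
  have := step (2 * L) le_rfl
  rw [show t + 2 * (2 * L) = t + 4 * L by ring] at this
  refine this.mono fun v ω ω' hE => ⟨hE.1, fun μ hμ hv => hE.2 μ hμ ?_ hv⟩
  exact ((hcol (key ω) ⟨ω, rfl⟩).1 μ hμ).1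

end Routing

end CongestedClique

/-! ### Locality: which data determine each step of ReduceDegree. -/

namespace ReduceDegree

variable {n : ℕ} {G G' : SimpleGraph (Fin n)} {v : Fin n}

open scoped Classical in
theorem edge1_congr (hN : ∀ u, G.Adj v u ↔ G'.Adj v u)
    (hd : ∀ u, G.Adj v u → G.degree u = G'.degree u) : edge1 G v = edge1 G' v := by
  have hc : candidates1 G v = candidates1 G' v := by
    ext u
    simp only [candidates1, Finset.mem_filter, SimpleGraph.mem_neighborFinset, ← hN]
    refine and_congr_right fun hu => forall₂_congr fun t ht => ?_
    rw [hd u hu, hd t ht]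
  simp only [edge1, hc]

/-- Equal labels mean equal components in each graph separately, so two labels decide the relation
without knowledge of the graph. -/
theorem reachable_congr (R : Rules n) {F F' : SimpleGraph (Fin n)} {u : Fin n}
    (hv : R.label F v = R.label F' v) (hu : R.label F u = R.label F' u) :
    F.Reachable v u ↔ F'.Reachable v u := by
  rw [← R.label_eq_iff, ← R.label_eq_iff, hv, hu]

theorem edge2_congr (R : Rules n) (hN : ∀ u, G.Adj v u ↔ G'.Adj v u)
    (hc : ∀ u, u = v ∨ G.Adj v u →
      componentMessage R G (graph1 G) u = componentMessage R G' (graph1 G') u) :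
    edge2 R G v = edge2 R G' v := by
  have hreach : ∀ u, G.Adj v u → ((graph1 G).Reachable v u ↔ (graph1 G').Reachable v u) :=
    fun u hu => reachable_congr R (congrArg Prod.fst (hc v (.inl rfl)))
      (congrArg Prod.fst (hc u (.inr hu)))
  have hdeg : ∀ u, G.Adj v u →
      componentDegree G (graph1 G) u = componentDegree G' (graph1 G') u :=
    fun u hu => congrArg Prod.snd (hc u (.inr hu))
  have h : candidates2 G v = candidates2 G' v := by
    ext u
    simp only [candidates2, Finset.mem_filter, SimpleGraph.mem_neighborFinset, ← hN]
    refine and_congr_right fun hu => and_congr (not_congr (hreach u hu)) ?_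
    refine forall₂_congr fun t ht => ?_
    rw [hreach t ht, hdeg t ht, hdeg u hu]
  simp only [edge2, h]

open scoped Classical in
theorem componentDegree_congr (F : SimpleGraph (Fin n)) (hd : ∀ w, G.degree w = G'.degree w) :
    componentDegree G F = componentDegree G' F := by
  funext v
  simp only [componentDegree, hd]

open scoped Classical in
theorem componentMessage_congr (R : Rules n) {F F' : SimpleGraph (Fin n)} (hF : F = F')
    (hd : ∀ w, G.degree w = G'.degree w) : componentMessage R G F = componentMessage R G' F' := by
  subst hF
  funext v
  simp only [componentMessage, componentDegree_congr F hd]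

/-- Bounds the number of possible component messages by `n * n`, which fits the message size. -/
theorem componentDegree_lt (G F : SimpleGraph (Fin n)) (v : Fin n) : componentDegree G F v < n := by
  classical
  have hn : ⊥ < n := v.pos
  rw [componentDegree, Finset.sup_lt_iff hn]
  intro w _
  simpa using G.degree_lt_card_verts w

theorem heard_congr {α : Type} {msg msg' : Fin n → α} (hN : ∀ u, G.Adj v u ↔ G'.Adj v u)
    (h : ∀ u, G.Adj v u → msg u = msg' u) : heard G msg v = heard G' msg' v := by
  classical
  funext u
  simp only [heard, ← hN]
  split_ifs with hu
  · rw [h u hu]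
  · rfl

open scoped Classical in
/-- The record of a node is determined by its neighbours and what the node and its neighbours
receive in the two stages. -/
theorem nodeRecord_congr (R : Rules n) (s : ℕ) (hN : ∀ u, G.Adj v u ↔ G'.Adj v u)
    (hd : ∀ u, G.Adj v u → G.degree u = G'.degree u)
    (hc₁ : ∀ u, u = v ∨ G.Adj v u →
      componentMessage R G (graph1 G) u = componentMessage R G' (graph1 G') u)
    (hc₂ : ∀ u, u = v ∨ G.Adj v u →
      componentMessage R G (graph2 R G) u = componentMessage R G' (graph2 R G') u) :
    nodeRecord R s G v = nodeRecord R s G' v := by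
  have hA : ∀ u, u = v ∨ G.Adj v u → (Awake R s G u ↔ Awake R s G' u) := fun u hu => by
    have : componentDegree G (graph2 R G) u = componentDegree G' (graph2 R G') u :=
      congrArg Prod.snd (hc₂ u hu)
    rw [Awake, Awake, this]
  have hAv := hA v (.inl rfl)
  simp only [nodeRecord, NodeRecord.mk.injEq]
  refine ⟨?_, heard_congr hN hd, edge1_congr hN hd, hc₁ v (.inl rfl),
    heard_congr hN fun u hu => hc₁ u (.inr hu), edge2_congr R hN hc₁, hc₂ v (.inl rfl),
    heard_congr hN fun u hu => hc₂ u (.inr hu), by simp only [hAv], ?_, ?_⟩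
  · ext u
    simp only [SimpleGraph.mem_neighborFinset, hN]
  · ext u
    simp only [SimpleGraph.mem_neighborFinset]
    change G.Adj v u ∧ _ ∧ _ ↔ G'.Adj v u ∧ _ ∧ _
    rw [← hN]
    exact and_congr_right fun hu => and_congr hAv (hA u (.inr hu))
  · ext u
    simp only [SimpleGraph.mem_neighborFinset]
    change G.Adj v u ∧ _ ↔ G'.Adj v u ∧ _
    rw [← hN]
    exact and_congr_right fun hu => or_congr (not_congr hAv) (not_congr (hA u (.inr hu)))

open scoped Classical in
/-- The record of the coordinator is determined by the degrees and the edges that it receives. -/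
theorem coordinatorRecord_congr (R : Rules n) (s : ℕ) (hd : ∀ w, G.degree w = G'.degree w)
    (h₁ : edge1 G = edge1 G') (h₂ : edge2 R G = edge2 R G') :
    coordinatorRecord R s G = coordinatorRecord R s G' := by
  have hg₁ : graph1 G = graph1 G' := congrArg sentGraph h₁
  have hg₂ : graph2 R G = graph2 R G' := by rw [graph2, graph2, hg₁, h₂]
  have hA : Awake R s G = Awake R s G' := by
    funext v
    rw [Awake, Awake, hg₂, componentDegree_congr _ hd]
  simp only [coordinatorRecord, h₁, h₂, hg₁, hg₂, componentMessage_congr R rfl hd, hA]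

end ReduceDegree

/-! ### Load balancing for proxies and servers. -/

namespace CongestedClique

open Finset

/-- An assignment of proxies, given upper bounds `d j` on the work per instance of each `j`. -/
theorem exists_proxy {n m H c : ℕ} (hH : 0 < H) (hmH : m ≤ H) (hHn : H * H ≤ 4 * n)
    (d : Fin n → ℕ) (hd : ∀ j, d j ≤ n) (hsum : ∑ j, d j ≤ (2 * c + 1) * n * H) :
    ∃ proxy : Fin m → Fin n → Fin n,
      (∀ v, {k | ∃ i, proxy i k = v}.ncard ≤ 2 * c + 2) ∧
      ∀ v, #{μ : Fin n × Fin m × Fin n | μ.2.2 < d μ.1 ∧ proxy μ.2.1 μ.1 = v} ≤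
        (5 * n) * (2 * c + 2) := by
  classical
  -- Each `j` gets `d j / H + 1` slots, in total at most `(2 * c + 1) * n + n`; each node offers `2
  -- * c + 2` slots.
  have hcard : Fintype.card (Σ j : Fin n, Fin (d j / H + 1)) ≤
      Fintype.card (Fin (2 * c + 2) × Fin n) := by
    simp only [Fintype.card_sigma, Fintype.card_fin, Fintype.card_prod, Finset.sum_add_distrib,
      Finset.sum_const, Finset.card_univ, smul_eq_mul, mul_one]
    have h₁ : ∑ j, d j / H ≤ (∑ j, d j) / H := by
      rw [Nat.le_div_iff_mul_le hH, Finset.sum_mul]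
      exact Finset.sum_le_sum fun j _ => Nat.div_mul_le_self _ _
    have h₂ : (∑ j, d j) / H ≤ (2 * c + 1) * n :=
      (Nat.div_le_div_right hsum).trans_eq (Nat.mul_div_cancel _ hH)
    calc _ ≤ (2 * c + 1) * n + n := by omega
      _ = _ := by ring
  obtain ⟨e⟩ := Function.Embedding.nonempty_of_card_le hcard
  -- The instances are dealt cyclically to the slots of `j`. As `e` is injective, a slot belongs to
  -- a single `j`.
  let slot : Fin m → Fin n → Fin (2 * c + 2) × Fin n := fun i j =>
    e ⟨j, ⟨i % (d j / H + 1), Nat.mod_lt _ (Nat.succ_pos _)⟩⟩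
  have hslot : ∀ i i' j j', slot i j = slot i' j' →
      j = j' ∧ (i : ℕ) % (d j / H + 1) = i' % (d j / H + 1) := by
    intro i i' j j' h
    have h := e.injective h
    obtain ⟨rfl, h⟩ := Sigma.mk.inj h
    exact ⟨rfl, by simpa using h⟩
  refine ⟨fun i j => (slot i j).2, fun v => ?_, fun v => ?_⟩
  · have key : ∀ k : {k | ∃ i, (slot i k).2 = v}, ∃ i, (slot i k).2 = v := fun k => k.2
    choose i hi using key
    have hinj : Function.Injective fun k : {k | ∃ i, (slot i k).2 = v} => (slot (i k) k).1 :=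
      fun k k' h => Subtype.ext (hslot _ _ _ _ (Prod.ext h ((hi k).trans (hi k').symm))).1
    have := Nat.card_le_card_of_injective _ hinj
    rwa [Nat.card_coe_set_eq, Nat.card_fin] at this
  · refine (Finset.card_le_mul_card_image_of_maps_to
      (f := fun μ : Fin n × Fin m × Fin n => (slot μ.2.1 μ.1).1) (t := univ)
      (fun _ _ => Finset.mem_univ _) (5 * n) fun x _ => ?_).trans_eq (by simp)
    rcases Finset.eq_empty_or_nonempty ({μ ∈ {μ : Fin n × Fin m × Fin n |
      μ.2.2 < d μ.1 ∧ (slot μ.2.1 μ.1).2 = v} | (slot μ.2.1 μ.1).1 = x} : Finset _) with h | ⟨ν, hν⟩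
    · rw [h]; simp
    set D := d ν.1 with hD
    set a := D / H + 1 with ha
    -- A slot handles at most `m / a + 1` instances with `D` requests each. The main term is at most
    -- `H * H ≤ 4 * n`, and the rounding term `D` is at most `n`.
    have hle : ((m / a + 1) * D) ≤ 5 * n := by
      have h₁ : D ≤ a * H := by
        have := Nat.div_add_mod D H
        have := Nat.mod_lt D hH
        rw [ha]; nlinarith
      have h₂ : m / a * D ≤ H * H := calc
        m / a * D ≤ m / a * (a * H) := Nat.mul_le_mul_left _ h₁
        _ = m / a * a * H := by ring
        _ ≤ m * H := Nat.mul_le_mul_right _ (Nat.div_mul_le_self _ _)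
        _ ≤ H * H := Nat.mul_le_mul_right _ hmH
      have h₃ : D ≤ n := hd ν.1
      rw [Nat.add_mul]
      omega
    refine le_trans ?_ hle
    have hmem : ∀ μ ∈ ({μ ∈ {μ : Fin n × Fin m × Fin n |
        μ.2.2 < d μ.1 ∧ (slot μ.2.1 μ.1).2 = v} | (slot μ.2.1 μ.1).1 = x} : Finset _),
        μ.1 = ν.1 ∧ μ.2.2 < D ∧ (μ.2.1 : ℕ) % a = ν.2.1 % a := by
      intro μ hμ
      simp only [Finset.mem_filter, Finset.mem_univ, true_and] at hμ hν
      obtain ⟨h₁, h₂⟩ := hslot ν.2.1 μ.2.1 ν.1 μ.1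
        (Prod.ext (hν.2.trans hμ.2.symm) (hν.1.2.trans hμ.1.2.symm))
      exact ⟨h₁.symm, by rw [hD, h₁]; exact hμ.1.1, h₂.symm⟩
    have : #(Finset.range (m / a + 1) ×ˢ Finset.range D) = (m / a + 1) * D := by simp
    rw [← this]
    refine Finset.card_le_card_of_injOn (fun μ => ((μ.2.1 : ℕ) / a, (μ.2.2 : ℕ))) ?_ ?_
    · intro μ hμ
      have := hmem μ hμ
      simp only [Finset.coe_product, Set.mem_prod, Finset.coe_range, Set.mem_Iio]
      exact ⟨Nat.lt_succ_of_le (Nat.div_le_div_right μ.2.1.2.le), this.2.1⟩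
    · intro μ hμ μ' hμ' h
      have h₁ := hmem μ hμ
      have h₂ := hmem μ' hμ'
      simp only [Prod.mk.injEq] at h
      refine Prod.ext (h₁.1.trans h₂.1.symm) (Prod.ext (Fin.ext ?_) (Fin.ext h.2))
      rw [← Nat.div_add_mod (μ.2.1 : ℕ) a, ← Nat.div_add_mod (μ'.2.1 : ℕ) a, h.1,
        h₁.2.2, h₂.2.2]

/-- A distribution of the requests `(j, i, r)` with `r < d j` among those nodes `u` that serve the
instance `i`, which are the nodes with `u % m = i`. -/
theorem exists_server {n m H c : ℕ} (hm : 0 < m) (hmn : m ≤ n) (hmH : m ≤ H)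
    (hHn : H * H ≤ 4 * n) :
    ∃ server : Fin m → Fin n → Fin n, (∀ i r, (server i r : ℕ) % m = i) ∧
      ∀ d : Fin n → ℕ, ∑ j, d j ≤ (2 * c + 1) * n * H →
        ∀ u, #{μ : Fin n × Fin m × Fin n | μ.2.2 < d μ.1 ∧ server μ.2.1 μ.2.2 = u} ≤
          (16 * c + 9) * n := by
  classical
  -- Each residue class mod `m` contains at least `h` nodes, and `H ≤ 8 * h`. Request `r` goes to
  -- the server numbered `r % h`.
  set h := n / m with hh
  have hpos : 0 < h := Nat.div_pos hmn hm
  have hH8 : H ≤ 8 * h := by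
    have h₁ : n < h * m + m := by
      have := Nat.div_add_mod n m
      have := Nat.mod_lt n hm
      rw [hh]; nlinarith
    have h₂ : m ≤ h * m := Nat.le_mul_of_pos_left _ hpos
    have h₃ : h * m ≤ h * H := Nat.mul_le_mul_left _ hmH
    by_contra! hlt
    have : 8 * h * H ≤ H * H := Nat.mul_le_mul_right _ hlt.le
    nlinarith
  have hlt : ∀ (i : Fin m) (r : Fin n), m * (r % h) + i < n := by
    intro i r
    have h₁ : (r : ℕ) % h + 1 ≤ h := Nat.mod_lt _ hpos
    have h₂ : m * (r % h + 1) ≤ m * h := Nat.mul_le_mul_left _ h₁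
    have h₃ : m * h ≤ n := Nat.mul_div_le n m
    have := i.2
    nlinarith
  refine ⟨fun i r => ⟨m * (r % h) + i, hlt i r⟩, fun i r => ?_, fun d hsum u => ?_⟩
  · simp [Nat.mod_eq_of_lt i.2]
  have hbound : ∑ j, (d j / h + 1) ≤ (16 * c + 9) * n := by
    rw [Finset.sum_add_distrib, Finset.sum_const, Finset.card_univ, Fintype.card_fin, smul_eq_mul,
      mul_one]
    have h₁ : ∑ j, d j / h ≤ (∑ j, d j) / h := by
      rw [Nat.le_div_iff_mul_le hpos, Finset.sum_mul]
      exact Finset.sum_le_sum fun j _ => Nat.div_mul_le_self _ _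
    have h₂ : (∑ j, d j) / h ≤ (2 * c + 1) * n * 8 := by
      refine Nat.div_le_of_le_mul (hsum.trans ?_)
      calc (2 * c + 1) * n * H ≤ (2 * c + 1) * n * (8 * h) := Nat.mul_le_mul_left _ hH8
        _ = _ := by ring
    calc _ ≤ (2 * c + 1) * n * 8 + n := by omega
      _ = _ := by ring
  refine le_trans ?_ hbound
  have : #((univ : Finset (Fin n)).sigma fun j => Finset.range (d j / h + 1)) =
      ∑ j, (d j / h + 1) := by simp
  rw [← this]
  -- The server `u` fixes both `i` and `r % h`, so a request reaching it is determined by `j` and `r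
  -- / h`.
  refine Finset.card_le_card_of_injOn (fun μ => ⟨μ.1, (μ.2.2 : ℕ) / h⟩) ?_ ?_
  · intro μ hμ
    simp only [Finset.coe_filter, Finset.mem_univ, true_and, Set.mem_ofPred_eq] at hμ
    simp only [Finset.coe_sigma, Finset.coe_univ, Set.mem_sigma_iff, Set.mem_univ, true_and,
      Finset.coe_range, Set.mem_Iio]
    exact Nat.lt_succ_of_le (Nat.div_le_div_right hμ.1.le)
  · intro μ hμ μ' hμ' heq
    simp only [Finset.coe_filter, Finset.mem_univ, true_and, Set.mem_ofPred_eq] at hμ hμ'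
    obtain ⟨h₁, h₂⟩ := Sigma.mk.inj heq
    have h₂ := eq_of_heq h₂
    have h₃ : m * ((μ.2.2 : ℕ) % h) + μ.2.1 = m * ((μ'.2.2 : ℕ) % h) + μ'.2.1 :=
      congrArg Fin.val (hμ.2.trans hμ'.2.symm)
    have h₄ : (μ.2.1 : ℕ) = μ'.2.1 := by
      have := congrArg (· % m) h₃
      simpa [Nat.mul_add_mod, Nat.mod_eq_of_lt μ.2.1.2, Nat.mod_eq_of_lt μ'.2.1.2] using this
    have h₅ : (μ.2.2 : ℕ) % h = μ'.2.2 % h := by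
      rw [h₄] at h₃
      exact Nat.eq_of_mul_eq_mul_left hm (Nat.add_right_cancel h₃)
    refine Prod.ext h₁ (Prod.ext (Fin.ext h₄) (Fin.ext ?_))
    rw [← Nat.div_add_mod (μ.2.2 : ℕ) h, ← Nat.div_add_mod (μ'.2.2 : ℕ) h, h₂, h₅]

end CongestedClique

/-! ### Communication between proxies and servers, and the simulation. -/

namespace CongestedClique

open Finset ReduceDegree

/-- The roles of the `n` nodes in `m` instances: the proxies, which depend on numbers `d j` that
bound the work for `j`, the nodes that answer the requests of the proxies, and the instance that
each node serves. -/
structure Layout (n m : ℕ) where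
  proxy : (Fin n → ℕ) → Fin m → Fin n → Fin n
  server : Fin m → Fin n → Fin n
  inst : Fin n → Fin m
  inst_server : ∀ i r, inst (server i r) = i

/-- The work of each node is at most `L` in the number of nodes for which it is a proxy, and at
most `L * n` in the number of requests `(j, i, r)` with `r < d j`. -/
structure Layout.Balanced {n m : ℕ} (Λ : Layout n m) (L : ℕ) (d : Fin n → ℕ) : Prop where
  ncard_le : ∀ v, {k | ∃ i, Λ.proxy d i k = v}.ncard ≤ L
  proxy_load : ∀ v, #{μ : Fin n × Fin m × Fin n | μ.2.2 < d μ.1 ∧ Λ.proxy d μ.2.1 μ.1 = v} ≤ L * n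
  server_load : ∀ v, #{μ : Fin n × Fin m × Fin n | μ.2.2 < d μ.1 ∧ Λ.server μ.2.1 μ.2.2 = v} ≤
    L * n

variable {n m b t L : ℕ} {Input Ω β : Type} {inp : Ω → Fin n → Input} {E : Fin n → Ω → Ω → Prop}
  {Λ : Layout n m} {key : Ω → Fin n → ℕ}

/-- The proxies of `j` send the requests `nb ω j r` with `r < key ω j`. -/
theorem Learnable.request (h : Learnable b inp t E)
    (hkey : ∀ v ω ω', E v ω ω' → key ω = key ω') (hΛ : ∀ ω, Λ.Balanced L (key ω))
    (hn : n ≤ 2 ^ b) (nb : Ω → Fin n → Fin n → Fin n)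
    (hnb : ∀ i j ω ω', E (Λ.proxy (key ω) i j) ω ω' → nb ω j = nb ω' j) :
    Learnable b inp (t + 4 * L) (fun v ω ω' => E v ω ω' ∧ ∀ i j (r : Fin n), (r : ℕ) < key ω j →
      Λ.server i r = v → nb ω j r = nb ω' j r) := by
  refine (h.route hkey L (fun d => ({μ | μ.2.2 < d μ.1} : Finset (Fin n × Fin m × Fin n)))
    (fun d μ => Λ.proxy d μ.2.1 μ.1) (fun _ μ => Λ.server μ.2.1 μ.2.2)
    (fun ω μ => nb ω μ.1 μ.2.2) univ (by simpa using hn) (fun _ _ => Finset.mem_univ _)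
    ?_ ?_ ?_).mono ?_
  · intro ω ω' μ _ hE
    simp only [hnb _ _ ω ω' hE]
  · intro ω v
    rw [Finset.filter_filter]
    exact (hΛ ω).proxy_load v
  · intro ω v
    rw [Finset.filter_filter]
    exact (hΛ ω).server_load v
  · exact fun v ω ω' hE => ⟨hE.1, fun i j r hr hv => hE.2 (j, i, r) (by simpa using hr) hv⟩

/-- The requests are answered: the proxy of `j` in instance `i` receives the entries
`T ω i (nb ω j r)` for all `r < key ω j`. -/
theorem Learnable.answer (h : Learnable b inp t E)
    (hkey : ∀ v ω ω', E v ω ω' → key ω = key ω') (hΛ : ∀ ω, Λ.Balanced L (key ω))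
    (nb : Ω → Fin n → Fin n → Fin n)
    (hnb : ∀ v ω ω', E v ω ω' → ∀ i j (r : Fin n), (r : ℕ) < key ω j → Λ.server i r = v →
      nb ω j r = nb ω' j r)
    (T : Ω → Fin m → Fin n → β) (F : Finset β) (hF : F.card ≤ 2 ^ b) (hTF : ∀ ω i w, T ω i w ∈ F)
    (hT : ∀ u ω ω', E u ω ω' → T ω (Λ.inst u) = T ω' (Λ.inst u)) :
    Learnable b inp (t + 4 * L) (fun v ω ω' => E v ω ω' ∧ ∀ i j (r : Fin n), (r : ℕ) < key ω j →
      Λ.proxy (key ω) i j = v → T ω i (nb ω j r) = T ω' i (nb ω' j r)) := by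
  refine (h.route hkey L (fun d => ({μ | μ.2.2 < d μ.1} : Finset (Fin n × Fin m × Fin n)))
    (fun _ μ => Λ.server μ.2.1 μ.2.2) (fun d μ => Λ.proxy d μ.2.1 μ.1)
    (fun ω μ => T ω μ.2.1 (nb ω μ.1 μ.2.2)) F hF (fun _ _ => hTF _ _ _) ?_ ?_ ?_).mono ?_
  · intro ω ω' μ hμ hE
    have h₁ := hT _ ω ω' hE
    rw [Λ.inst_server] at h₁
    simp only [h₁, hnb _ ω ω' hE μ.2.1 μ.1 μ.2.2 (by simpa using hμ) rfl]
  · intro ω v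
    rw [Finset.filter_filter]
    exact (hΛ ω).server_load v
  · intro ω v
    rw [Finset.filter_filter]
    exact (hΛ ω).proxy_load v
  · exact fun v ω ω' hE => ⟨hE.1, fun i j r hr hv => hE.2 (j, i, r) (by simpa using hr) hv⟩

theorem Layout.Balanced.card_le {d : Fin n → ℕ} (h : Λ.Balanced L d) (v : Fin n) :
    #{k | ∃ i, Λ.proxy d i k = v} ≤ L := by
  have := h.ncard_le v
  rwa [Set.ncard_eq_toFinset_card', Set.toFinset_ofPred] at this

/-- All proxies in the instance `i` send a value to all nodes that serve `i`. -/
theorem Learnable.gather (h : Learnable b inp t E)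
    (hkey : ∀ v ω ω', E v ω ω' → key ω = key ω') (hΛ : ∀ ω, Λ.Balanced L (key ω)) (hL : 0 < L)
    (e : Ω → Fin m → Fin n → β) (F : Finset β) (hF : F.card ≤ 2 ^ b) (heF : ∀ ω i w, e ω i w ∈ F)
    (he : ∀ i j ω ω', E (Λ.proxy (key ω) i j) ω ω' → e ω i j = e ω' i j) :
    Learnable b inp (t + 4 * L) (fun v ω ω' => E v ω ω' ∧ e ω (Λ.inst v) = e ω' (Λ.inst v)) := by
  -- The pair `(k, v)` stands for the message about `k` to `v`. Every server of an instance gets the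
  -- whole table, so each of them can act as its coordinator.
  refine (h.route hkey L (fun _ => (univ : Finset (Fin n × Fin n)))
    (fun d μ => Λ.proxy d (Λ.inst μ.2) μ.1) (fun _ μ => μ.2)
    (fun ω μ => e ω (Λ.inst μ.2) μ.1) F hF (fun _ _ => heF _ _ _) ?_ ?_ ?_).mono ?_
  · exact fun ω ω' μ _ hE => he _ _ ω ω' hE
  · intro ω v
    calc _ ≤ #(({k | ∃ i, Λ.proxy (key ω) i k = v} : Finset (Fin n)) ×ˢ (univ : Finset (Fin n))) := by
          refine Finset.card_le_card fun μ hμ => ?_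
          simp only [Finset.mem_filter, Finset.mem_univ, true_and, Finset.mem_product,
            and_true] at hμ ⊢
          exact ⟨_, hμ⟩
      _ ≤ L * n := by
          rw [Finset.card_product, Finset.card_univ, Fintype.card_fin]
          exact Nat.mul_le_mul_right _ ((hΛ ω).card_le v)
  · intro ω v
    calc _ ≤ #((univ : Finset (Fin n)) ×ˢ ({v} : Finset (Fin n))) := by
          refine Finset.card_le_card fun μ hμ => ?_
          exact Finset.mem_product.2
            ⟨Finset.mem_univ _, Finset.mem_singleton.2 (Finset.mem_filter.1 hμ).2⟩
      _ ≤ L * n := by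
          simpa using Nat.le_mul_of_pos_left n hL
  · exact fun v ω ω' hE => ⟨hE.1, funext fun k => hE.2 (k, v) (Finset.mem_univ _) rfl⟩

/-- All nodes send their relation to `j` to all proxies of `j`. -/
theorem Learnable.scatter (h : Learnable b inp t E)
    (hkey : ∀ v ω ω', E v ω ω' → key ω = key ω') (hΛ : ∀ ω, Λ.Balanced L (key ω))
    (e : Ω → Fin n → Fin n → β) (F : Finset β) (hF : F.card ≤ 2 ^ b) (heF : ∀ ω i w, e ω i w ∈ F)
    (he : ∀ w ω ω', E w ω ω' → e ω w = e ω' w) :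
    Learnable b inp (t + 4 * L) (fun v ω ω' => E v ω ω' ∧ ∀ i j, Λ.proxy (key ω) i j = v →
      ∀ w, e ω w j = e ω' w j) := by
  refine (h.route hkey L (fun d => ({μ | ∃ i, Λ.proxy d i μ.2.1 = μ.2.2} :
      Finset (Fin n × Fin n × Fin n)))
    (fun _ μ => μ.1) (fun _ μ => μ.2.2)
    (fun ω μ => e ω μ.1 μ.2.1) F hF (fun _ _ => heF _ _ _) ?_ ?_ ?_).mono ?_
  · intro ω ω' μ _ hE
    simp only [he _ ω ω' hE]
  · intro ω v
    calc _ ≤ #((univ : Finset (Fin n)).sigma fun u => {k | ∃ i, Λ.proxy (key ω) i k = u}) := by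
          refine Finset.card_le_card_of_injOn (fun μ => ⟨μ.2.2, μ.2.1⟩) ?_ ?_
          · intro μ hμ
            simpa using (Finset.mem_filter.1 (Finset.mem_filter.1 hμ).1).2
          · intro μ hμ μ' hμ' heq
            obtain ⟨h₁, h₂⟩ := Sigma.mk.inj heq
            exact Prod.ext ((Finset.mem_filter.1 hμ).2.trans (Finset.mem_filter.1 hμ').2.symm)
              (Prod.ext (eq_of_heq h₂) h₁)
      _ ≤ ∑ _u : Fin n, L := by
          rw [Finset.card_sigma]
          exact Finset.sum_le_sum fun u _ => (hΛ ω).card_le u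
      _ = L * n := by simp [mul_comm]
  · intro ω v
    calc _ ≤ #((univ : Finset (Fin n)) ×ˢ ({k | ∃ i, Λ.proxy (key ω) i k = v} : Finset (Fin n))) := by
          refine Finset.card_le_card_of_injOn (fun μ => (μ.1, μ.2.1)) ?_ ?_
          · intro μ hμ
            have h₁ := (Finset.mem_filter.1 (Finset.mem_filter.1 hμ).1).2
            rw [(Finset.mem_filter.1 hμ).2] at h₁
            simpa using h₁
          · intro μ hμ μ' hμ' heq
            simp only [Prod.mk.injEq] at heq
            exact Prod.ext heq.1 (Prod.ext heq.2
              ((Finset.mem_filter.1 hμ).2.trans (Finset.mem_filter.1 hμ').2.symm))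
      _ ≤ L * n := by
          rw [Finset.card_product, Finset.card_univ, Fintype.card_fin, mul_comm]
          exact Nat.mul_le_mul_right _ ((hΛ ω).card_le v)
  · exact fun v ω ω' hE => ⟨hE.1, fun i j hv w =>
      hE.2 (w, j, v) (Finset.mem_filter.2 ⟨Finset.mem_univ _, i, hv⟩) rfl⟩

/-- Numbers the requests of a proxy; indices beyond the set yield the default `x`. -/
theorem exists_enumeration {V : Type} (S : Finset V) (x : V) :
    ∃ f : ℕ → V, ∀ w ∈ S, ∃ r < #S, f r = w := by
  refine ⟨fun r => S.toList.getD r x, fun w hw => ?_⟩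
  obtain ⟨r, hr, rfl⟩ := List.getElem_of_mem (Finset.mem_toList.2 hw)
  exact ⟨r, by simpa using hr, List.getD_eq_getElem _ _ hr⟩

open scoped Classical in
/-- In an increasing sequence of graphs, the pairs of nodes are adjacent in the same graphs if
they are so equally often. -/
theorem adj_iff_of_card_eq {G G' : Fin m → SimpleGraph (Fin n)} (hG : Monotone G)
    (hG' : Monotone G') {u v : Fin n} (h : #{i | (G i).Adj u v} = #{i | (G' i).Adj u v})
    (i : Fin m) : (G i).Adj u v ↔ (G' i).Adj u v := by
  -- Both index sets are upward closed in a linear order, hence nested, and equal size forces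
  -- equality.
  have key : ({i | (G i).Adj u v} : Finset (Fin m)) = ({i | (G' i).Adj u v} : Finset _) := by
    by_cases hsub : ({i | (G i).Adj u v} : Finset (Fin m)) ⊆ ({i | (G' i).Adj u v} : Finset _)
    · exact Finset.eq_of_subset_of_card_le hsub h.ge
    · obtain ⟨a, ha, ha'⟩ := Finset.not_subset.1 hsub
      simp only [Finset.mem_filter, Finset.mem_univ, true_and] at ha ha'
      refine (Finset.eq_of_subset_of_card_le (fun c hc => ?_) h.le).symm
      simp only [Finset.mem_filter, Finset.mem_univ, true_and] at hc ⊢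
      rcases le_total c a with hca | hac
      · exact absurd (hG' hca hc) ha'
      · exact hG hac ha
  simpa using congrArg (i ∈ ·) key

open scoped Classical in
/-- Execution of ReduceDegree on an increasing sequence of graphs, where the roles are distributed
according to the degrees in the last graph. -/
theorem learnable_reduceDegree (hn : 2 ≤ n) (hmn : m ≤ n) (hb : n * n ≤ 2 ^ b) (hL : 0 < L)
    (R : Rules n) (s : ℕ) (Λ : Layout n m) (G : Ω → Fin m → SimpleGraph (Fin n))
    (hG : ∀ ω, Monotone (G ω)) (last : Fin m) (hlast : ∀ i, i ≤ last) (key : Ω → Fin n → ℕ)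
    (hkey : ∀ ω j, key ω j = (G ω last).degree j + 1) (hΛ : ∀ ω, Λ.Balanced L (key ω)) :
    Learnable b (fun ω => neighbourInput (G ω)) (2 + 28 * L) (fun v ω ω' => key ω = key ω' ∧
      (∀ i j, Λ.proxy (key ω) i j = v →
        nodeRecord R s (G ω i) j = nodeRecord R s (G ω' i) j) ∧
      coordinatorRecord R s (G ω (Λ.inst v)) = coordinatorRecord R s (G ω' (Λ.inst v))) := by
  have hn₁ : n ≤ 2 ^ b := by nlinarith
  -- Needed for `Option (Fin n)` and for counts from 0 to `m`; this is where `2 ≤ n` matters.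
  have hn₂ : n + 1 ≤ 2 ^ b := by nlinarith
  have hrange : #(range n) ≤ 2 ^ b := by simpa using hn₁
  have hdeg : ∀ ω i w, (G ω i).degree w ∈ range n := fun ω i w => by
    simpa using (G ω i).degree_lt_card_verts w
  -- The closed neighbourhood in the last graph contains those in all earlier graphs, so one request
  -- list serves every instance. Including `j` itself explains the `+ 1` in `key`.
  let N : Ω → Fin n → Finset (Fin n) := fun ω j => insert j ((G ω last).neighborFinset j)
  have hN : ∀ ω j, #(N ω j) = key ω j := fun ω j => by
    rw [hkey, Finset.card_insert_of_notMem (by simp), SimpleGraph.card_neighborFinset_eq_degree]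
  choose enum henum using fun (S : Finset (Fin n)) (x : Fin n) => exists_enumeration S x
  let nb : Ω → Fin n → Fin n → Fin n := fun ω j r => enum (N ω j) j r
  have hsurj : ∀ ω i j w, w = j ∨ (G ω i).Adj j w → ∃ r : Fin n, (r : ℕ) < key ω j ∧
      nb ω j r = w := by
    intro ω i j w hw
    have hmem : w ∈ N ω j := by
      rcases hw with rfl | hw
      · exact Finset.mem_insert_self _ _
      · exact Finset.mem_insert_of_mem (by simpa using hG ω (hlast i) hw)
    obtain ⟨r, hr, hrw⟩ := henum (N ω j) j w hmem
    have : #(N ω j) ≤ n := by simpa using (N ω j).card_le_univ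
    exact ⟨⟨r, by omega⟩, by rwa [← hN], hrw⟩
  -- the input and the degrees
  let E₁ : Fin n → Ω → Ω → Prop := fun v ω ω' => key ω = key ω' ∧
    (∀ i u, (G ω i).Adj v u ↔ (G ω' i).Adj v u) ∧
    (∀ w, (G ω (Λ.inst v)).degree w = (G ω' (Λ.inst v)).degree w)
  have h₁ : Learnable b (fun ω => neighbourInput (G ω)) 2 E₁ := by
    have hown : ∀ v ω ω', neighbourInput (G ω) v = neighbourInput (G ω') v → ∀ i,
        (G ω i).neighborFinset v = (G ω' i).neighborFinset v := fun v ω ω' h i => congrFun h i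
    have hdown : ∀ v ω ω', neighbourInput (G ω) v = neighbourInput (G ω') v → ∀ i,
        (G ω i).degree v = (G ω' i).degree v := fun v ω ω' h i => by
      rw [← SimpleGraph.card_neighborFinset_eq_degree, hown v ω ω' h i,
        SimpleGraph.card_neighborFinset_eq_degree]
    -- The first round makes the key common knowledge; in the second, `u` tells `v` its degree in
    -- the one instance that `v` serves.
    refine (((learnable_input b fun ω => neighbourInput (G ω)).exchange (range n) hrange
      (fun ω u _ => (G ω last).degree u) (fun ω u _ => hdeg ω _ u) ?_).exchange (range n) hrange
      (fun ω u v => (G ω (Λ.inst v)).degree u) (fun ω u v => hdeg ω _ u) ?_).mono ?_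
    · exact fun u ω ω' h => funext fun _ => hdown u ω ω' h last
    · exact fun u ω ω' h => funext fun v => hdown u ω ω' h.1 _
    · rintro v ω ω' ⟨⟨h₁, h₂⟩, h₃⟩
      refine ⟨funext fun j => by rw [hkey, hkey, h₂ j], fun i u => ?_, h₃⟩
      rw [← SimpleGraph.mem_neighborFinset, hown v ω ω' h₁ i, SimpleGraph.mem_neighborFinset]
  -- the neighbours
  let E₂ : Fin n → Ω → Ω → Prop := fun v ω ω' => E₁ v ω ω' ∧
    ∀ i j, Λ.proxy (key ω) i j = v → ∀ i' w, (G ω i').Adj j w ↔ (G ω' i').Adj j w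
  have h₂ : Learnable b (fun ω => neighbourInput (G ω)) (2 + 4 * L) E₂ := by
    refine (h₁.scatter (fun v ω ω' h => h.1) hΛ (fun ω w j => #{i | (G ω i).Adj w j})
      (range (n + 1)) (by simpa using hn₂) ?_ ?_).mono ?_
    · intro ω w j
      have := Finset.card_le_univ ({i | (G ω i).Adj w j} : Finset (Fin m))
      rw [Fintype.card_fin] at this
      exact Finset.mem_range.2 (by omega)
    · intro w ω ω' h
      funext j
      simp only [h.2.1]
    · rintro v ω ω' ⟨h, hc⟩
      refine ⟨h, fun i j hv i' w => ?_⟩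
      rw [SimpleGraph.adj_comm, SimpleGraph.adj_comm (G ω' i')]
      exact adj_iff_of_card_eq (hG ω) (hG ω') (hc i j hv w) i'
  have hnb : ∀ i j ω ω', E₂ (Λ.proxy (key ω) i j) ω ω' → nb ω j = nb ω' j := by
    intro i j ω ω' h
    have : N ω j = N ω' j := by
      ext w
      simp only [N, Finset.mem_insert, SimpleGraph.mem_neighborFinset, h.2 i j rfl]
    funext r
    simp only [nb, this]
  -- the requests
  let E₃ : Fin n → Ω → Ω → Prop := fun v ω ω' => E₂ v ω ω' ∧
    ∀ i j (r : Fin n), (r : ℕ) < key ω j → Λ.server i r = v → nb ω j r = nb ω' j r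
  have h₃ : Learnable b (fun ω => neighbourInput (G ω)) (2 + 4 * L + 4 * L) E₃ :=
    h₂.request (fun v ω ω' h => h.1.1) hΛ hn₁ nb hnb
  -- The requests have been transmitted once in `E₃`; each further table held by the servers costs
  -- just one routing of answers.
  have lookup : ∀ {t : ℕ} {E : Fin n → Ω → Ω → Prop} {β : Type} (T : Ω → Fin m → Fin n → β)
      (F : Finset β), Learnable b (fun ω => neighbourInput (G ω)) t E →
      (∀ v ω ω', E v ω ω' → E₃ v ω ω') → F.card ≤ 2 ^ b → (∀ ω i w, T ω i w ∈ F) →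
      (∀ u ω ω', E u ω ω' → T ω (Λ.inst u) = T ω' (Λ.inst u)) →
      Learnable b (fun ω => neighbourInput (G ω)) (t + 4 * L) (fun v ω ω' => E v ω ω' ∧
        ∀ i j, Λ.proxy (key ω) i j = v → ∀ w, w = j ∨ (G ω i).Adj j w →
          T ω i w = T ω' i w) := by
    intro t E β T F h hE hF hTF hT
    refine (h.answer (fun v ω ω' h => (hE v ω ω' h).1.1.1) hΛ nb
      (fun v ω ω' h => (hE v ω ω' h).2) T F hF hTF hT).mono ?_
    rintro v ω ω' ⟨hE', h'⟩
    refine ⟨hE', ?_⟩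
    rintro i j rfl w hw
    obtain ⟨r, hr, rfl⟩ := hsurj ω i j w hw
    have := h' i j r hr rfl
    rwa [← hnb i j ω ω' (hE _ _ _ hE').1] at this
  -- the execution of the algorithm
  have h₄ := lookup (fun ω i w => (G ω i).degree w) (range n) h₃ (fun _ _ _ h => h) hrange
    (fun ω i w => hdeg ω i w) (fun u ω ω' h => funext h.1.1.2.2)
  have h₅ := h₄.gather (fun v ω ω' h => h.1.1.1.1) hΛ hL (fun ω i j => edge1 (G ω i) j) univ
    (by simpa using hn₂) (fun _ _ _ => Finset.mem_univ _)
    fun i j ω ω' h => edge1_congr (h.1.1.2 i j rfl i) fun u hu => h.2 i j rfl u (.inr hu)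
  have hcard : #((univ : Finset (Fin n)) ×ˢ range n) ≤ 2 ^ b := by simpa using hb
  have hcm : ∀ G F : SimpleGraph (Fin n), ∀ w,
      componentMessage R G F w ∈ (univ : Finset (Fin n)) ×ˢ range n := fun G F w =>
    Finset.mem_product.2 ⟨Finset.mem_univ _, Finset.mem_range.2 (componentDegree_lt G F w)⟩
  have h₆ := lookup (fun ω i => componentMessage R (G ω i) (graph1 (G ω i)))
    ((univ : Finset (Fin n)) ×ˢ range n) h₅ (fun _ _ _ h => h.1.1) hcard
    (fun ω i w => hcm _ _ w)
    fun u ω ω' h => componentMessage_congr R (congrArg sentGraph h.2) h.1.1.1.1.2.2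
  have h₇ := h₆.gather (fun v ω ω' h => h.1.1.1.1.1.1) hΛ hL (fun ω i j => edge2 R (G ω i) j) univ
    (by simpa using hn₂) (fun _ _ _ => Finset.mem_univ _)
    fun i j ω ω' h => edge2_congr R (h.1.1.1.1.2 i j rfl i) (h.2 i j rfl)
  have h₈ := lookup (fun ω i => componentMessage R (G ω i) (graph2 R (G ω i)))
    ((univ : Finset (Fin n)) ×ˢ range n) h₇ (fun _ _ _ h => h.1.1.1.1) hcard
    (fun ω i w => hcm _ _ w)
    fun u ω ω' h => componentMessage_congr R
      (congrArg₂ (· ⊔ ·) (congrArg sentGraph h.1.1.2) (congrArg sentGraph h.2))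
      h.1.1.1.1.1.1.2.2
  -- Seven routings of `4 * L` rounds: one scatter, one request, three lookups, two gathers.
  rw [show 2 + 28 * L = 2 + 4 * L + 4 * L + 4 * L + 4 * L + 4 * L + 4 * L + 4 * L by ring]
  refine h₈.mono ?_
  rintro v ω ω' ⟨⟨⟨⟨⟨hE₃, hd⟩, he₁⟩, hc₁⟩, he₂⟩, hc₂⟩
  exact ⟨hE₃.1.1.1, fun i j hv => nodeRecord_congr R s (hE₃.1.2 i j hv i)
      (fun u hu => hd i j hv u (.inr hu)) (hc₁ i j hv) (hc₂ i j hv),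
    coordinatorRecord_congr R s hE₃.1.1.2.2 he₁ he₂⟩

open scoped Classical in
theorem sum_degree_add_one_le {C : ℝ} (hn : 0 < n) (G : SimpleGraph (Fin n))
    (hG : (G.edgeSet.ncard : ℝ) ≤ C * (n : ℝ) ^ (3 / 2 : ℝ)) :
    ∑ j, (G.degree j + 1) ≤ (2 * ⌈C⌉₊ + 1) * n * ⌈Real.sqrt n⌉₊ := by
  have hn' : (0 : ℝ) < n := by exact_mod_cast hn
  have hH : 1 ≤ ⌈Real.sqrt n⌉₊ := Nat.one_le_ceil_iff.2 (Real.sqrt_pos.2 hn')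
  have hpow : (n : ℝ) ^ (3 / 2 : ℝ) = n * Real.sqrt n := by
    rw [Real.sqrt_eq_rpow, show (3 / 2 : ℝ) = 1 + 1 / 2 by norm_num, Real.rpow_add hn',
      Real.rpow_one]
  have hcard : #G.edgeFinset ≤ ⌈C⌉₊ * (n * ⌈Real.sqrt n⌉₊) := by
    rw [← SimpleGraph.coe_edgeFinset, Set.ncard_coe_finset, hpow] at hG
    have h : (#G.edgeFinset : ℝ) ≤ ⌈C⌉₊ * (n * ⌈Real.sqrt n⌉₊) := by
      refine hG.trans ?_
      gcongr
      · exact Nat.le_ceil C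
      · exact Nat.le_ceil _
    exact_mod_cast h
  rw [Finset.sum_add_distrib, SimpleGraph.sum_degrees_eq_twice_card_edges, Finset.sum_const,
    Finset.card_univ, Fintype.card_fin, smul_eq_mul, mul_one]
  have h : n * 1 ≤ n * ⌈Real.sqrt n⌉₊ := Nat.mul_le_mul_left _ hH
  nlinarith

theorem ceil_sqrt_mul_self_le (hn : 0 < n) :
    ⌈Real.sqrt n⌉₊ * ⌈Real.sqrt n⌉₊ ≤ 4 * n := by
  have h₁ : (1 : ℝ) ≤ Real.sqrt n := by
    rw [Real.one_le_sqrt]; exact_mod_cast hn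
  have h₂ := (Nat.ceil_lt_add_one (Real.sqrt_nonneg n)).le
  have h₃ := Real.mul_self_sqrt (Nat.cast_nonneg (α := ℝ) n)
  have h : ((⌈Real.sqrt n⌉₊ * ⌈Real.sqrt n⌉₊ : ℕ) : ℝ) ≤ (4 * n : ℕ) := by
    push_cast
    nlinarith [Nat.cast_nonneg (α := ℝ) ⌈Real.sqrt n⌉₊]
  exact_mod_cast h

theorem ceil_sqrt_le (n : ℕ) : ⌈Real.sqrt n⌉₊ ≤ n := by
  refine Nat.ceil_le.2 (Real.sqrt_le_iff.2 ⟨Nat.cast_nonneg n, ?_⟩)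
  exact_mod_cast Nat.le_self_pow two_ne_zero n

/-- The load `16 * c + 10` dominates the proxy count `2 * c + 2`, the proxy load `5 * (2 * c + 2)`
and the server load `16 * c + 9`. Node `i < m` has residue `i`, so it can be the coordinator of
instance `i`. -/
theorem exists_layout {c H : ℕ} (hm : 0 < m) (hmn : m ≤ n) (hmH : m ≤ H) (hHn : H * H ≤ 4 * n) :
    ∃ Λ : Layout n m, (∀ i : Fin m, Λ.inst ⟨i, i.2.trans_le hmn⟩ = i) ∧
      ∀ d : Fin n → ℕ, (∀ j, d j ≤ n) → ∑ j, d j ≤ (2 * c + 1) * n * H →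
        Λ.Balanced (16 * c + 10) d := by
  classical
  obtain ⟨server, hserver, hload⟩ := exists_server (c := c) hm hmn hmH hHn
  have hproxy : ∀ d : Fin n → ℕ, ∃ proxy : Fin m → Fin n → Fin n, (∀ j, d j ≤ n) →
      ∑ j, d j ≤ (2 * c + 1) * n * H → (∀ v, {k | ∃ i, proxy i k = v}.ncard ≤ 2 * c + 2) ∧
      ∀ v, #{μ : Fin n × Fin m × Fin n | μ.2.2 < d μ.1 ∧ proxy μ.2.1 μ.1 = v} ≤
        (5 * n) * (2 * c + 2) := by
    intro d
    by_cases h : (∀ j, d j ≤ n) ∧ ∑ j, d j ≤ (2 * c + 1) * n * H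
    · obtain ⟨proxy, hp⟩ := exists_proxy (hm.trans_le hmH) hmH hHn d h.1 h.2
      exact ⟨proxy, fun _ _ => hp⟩
    -- An arbitrary assignment for sequences `d` that violate the bounds.
    · exact ⟨fun _ j => j, fun h₁ h₂ => absurd ⟨h₁, h₂⟩ h⟩
  choose proxy hproxy using hproxy
  refine ⟨⟨proxy, server, fun u => ⟨u % m, Nat.mod_lt _ hm⟩, fun i r => Fin.ext (hserver i r)⟩,
    fun i => Fin.ext (Nat.mod_eq_of_lt i.2), fun d h₁ h₂ => ⟨fun v => ?_, fun v => ?_, fun v => ?_⟩⟩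
  · exact ((hproxy d h₁ h₂).1 v).trans (by omega)
  · exact ((hproxy d h₁ h₂).2 v).trans (by nlinarith)
  · exact (hload d h₂ v).trans (Nat.mul_le_mul_right _ (by omega))

end CongestedClique

/-! ### Assembly for sparse increasing sequences. -/

namespace CongestedClique

open Finset ReduceDegree

/-- The increasing sequences of `m` graphs with at most `C * n ^ (3 / 2)` edges each. -/
abbrev SparseChain (C : ℝ) (n m : ℕ) : Type :=
  {G : Fin m → SimpleGraph (Fin n) // Monotone G ∧
    ∀ i, ((G i).edgeSet.ncard : ℝ) ≤ C * (n : ℝ) ^ (3 / 2 : ℝ)}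

theorem exists_algorithm (C : ℝ) {n m : ℕ} (s : ℕ) (hm : m ≤ ⌈Real.sqrt (n : ℝ)⌉₊)
    (R : Rules n) :
    ∃ (A : Algorithm n (Fin m → Finset (Fin n)) (2 * Nat.clog 2 n))
      (proxy : SparseChain C n m → Fin m → Fin n → Fin n),
      (∀ G v, {k | ∃ i, proxy G i k = v}.ncard ≤ 16 * ⌈C⌉₊ + 10) ∧
      ∀ v (G G' : SparseChain C n m), neighbourInput G.1 v = neighbourInput G'.1 v →
        A.received (neighbourInput G.1) (2 + 28 * (16 * ⌈C⌉₊ + 10)) v =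
          A.received (neighbourInput G'.1) (2 + 28 * (16 * ⌈C⌉₊ + 10)) v →
        proxy G = proxy G' ∧
        (∀ i j, proxy G i j = v → nodeRecord R s (G.1 i) j = nodeRecord R s (G'.1 i) j) ∧
        ∀ i : Fin m, Fin.castLE (hm.trans (ceil_sqrt_le n)) i = v →
          coordinatorRecord R s (G.1 i) = coordinatorRecord R s (G'.1 i) := by
  classical
  -- In these cases there is at most one input, so nothing has to be communicated.
  by_cases hsmall : n ≤ 1 ∨ m = 0
  · have hG : ∀ G G' : SparseChain C n m, G = G' := by
      intro G G'
      refine Subtype.ext (funext fun i => ?_)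
      rcases hsmall with hn | rfl
      · have : Subsingleton (Fin n) := Fin.subsingleton_iff_le_one.2 hn
        exact Subsingleton.elim _ _
      · exact i.elim0
    refine ⟨⟨fun _ _ _ _ => ⟨[], by simp⟩⟩, fun _ _ j => j, fun G v => ?_, ?_⟩
    · refine (Set.ncard_le_ncard (t := {v}) (fun k hk => ?_) (Set.finite_singleton v)).trans ?_
      · obtain ⟨-, rfl⟩ := hk
        exact Set.mem_singleton _
      · rw [Set.ncard_singleton]; omega
    · intro v G G' _ _
      obtain rfl := hG G G'
      exact ⟨rfl, fun _ _ _ => rfl, fun _ _ => rfl⟩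
  · push Not at hsmall
    obtain ⟨hn, hm₀⟩ := hsmall
    have hmpos : 0 < m := Nat.pos_of_ne_zero hm₀
    have hmn : m ≤ n := hm.trans (ceil_sqrt_le n)
    have hb : n * n ≤ 2 ^ (2 * Nat.clog 2 n) := by
      have h := Nat.le_pow_clog one_lt_two n
      calc n * n ≤ 2 ^ Nat.clog 2 n * 2 ^ Nat.clog 2 n := Nat.mul_le_mul h h
        _ = _ := by rw [← pow_add, two_mul]
    obtain ⟨Λ, hinst, hΛ⟩ := exists_layout (c := ⌈C⌉₊) hmpos hmn hm
      (ceil_sqrt_mul_self_le (by omega))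
    let last : Fin m := ⟨m - 1, by omega⟩
    let key : SparseChain C n m → Fin n → ℕ := fun G j => (G.1 last).degree j + 1
    have hbal : ∀ G, Λ.Balanced (16 * ⌈C⌉₊ + 10) (key G) := fun G =>
      hΛ _ (fun j => Nat.succ_le_of_lt (by simpa using (G.1 last).degree_lt_card_verts j))
        (sum_degree_add_one_le (by omega) _ (G.2.2 last))
    obtain ⟨A, hA⟩ := learnable_reduceDegree hn hmn hb (by omega) R s Λ
      (fun G : SparseChain C n m => G.1) (fun G => G.2.1) last
      (fun i => Fin.le_def.2 (Nat.le_sub_one_of_lt i.2)) key (fun _ _ => rfl) hbal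
    refine ⟨A, fun G => Λ.proxy (key G), fun G => (hbal G).ncard_le, fun v G G' h₁ h₂ => ?_⟩
    obtain ⟨h₃, h₄, h₅⟩ := hA v G G' h₁ h₂
    refine ⟨congrArg _ h₃, h₄, ?_⟩
    rintro i rfl
    have : Λ.inst (Fin.castLE hmn i) = i := hinst i
    rwa [this] at h₅

end CongestedClique

theorem mainTheorem7 :
    ∃ B : ℕ, ∀ C : ℝ, ∃ K P : ℕ, ∀ n m s : ℕ, m ≤ ⌈Real.sqrt (n : ℝ)⌉₊ →
      ∀ R : ReduceDegree.Rules n,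
      ∃ (A : CongestedClique.Algorithm n (Fin m → Finset (Fin n)) (B * Nat.clog 2 n))
        (coordinator : Fin m → Fin n)
        (proxyTable : CongestedClique.LocalOutput n (Fin m → Finset (Fin n)) (B * Nat.clog 2 n)
          (Fin m → Fin n → Fin n))
        (proxyResult : CongestedClique.LocalOutput n (Fin m → Finset (Fin n)) (B * Nat.clog 2 n)
          (Fin m → Fin n → ReduceDegree.NodeRecord n))
        (coordinatorResult : CongestedClique.LocalOutput n (Fin m → Finset (Fin n))
          (B * Nat.clog 2 n) (Fin m → ReduceDegree.CoordinatorRecord n)),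
        Function.Injective coordinator ∧
        ∀ G : Fin m → SimpleGraph (Fin n), Monotone G →
          (∀ i, ((G i).edgeSet.ncard : ℝ) ≤ C * (n : ℝ) ^ (3 / 2 : ℝ)) →
          ∃ proxy : Fin m → Fin n → Fin n,
            (∀ v : Fin n, {k : Fin n | ∃ i : Fin m, proxy i k = v}.ncard ≤ P) ∧
            (∀ v : Fin n,
              A.output (CongestedClique.neighbourInput G) K proxyTable v = proxy) ∧
            (∀ (i : Fin m) (j : Fin n),
              A.output (CongestedClique.neighbourInput G) K proxyResult (proxy i j) i j =
                ReduceDegree.nodeRecord R s (G i) j) ∧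
            (∀ i : Fin m,
              A.output (CongestedClique.neighbourInput G) K coordinatorResult (coordinator i) i =
                ReduceDegree.coordinatorRecord R s (G i)) := by
  -- The factor 2 is for the pairs of label and degree, which take up to `n * n` values.
  refine ⟨2, fun C => ⟨2 + 28 * (16 * ⌈C⌉₊ + 10), 16 * ⌈C⌉₊ + 10, fun n m s hm R => ?_⟩⟩
  have hmn : m ≤ n := hm.trans (CongestedClique.ceil_sqrt_le n)
  obtain ⟨A, proxy, hcard, hA⟩ := CongestedClique.exists_algorithm C s hm R
  have : Nonempty (Fin m → Fin n → Fin n) := ⟨fun _ j => j⟩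
  obtain ⟨f₁, hf₁⟩ := CongestedClique.exists_localOutput (α := Fin m → Fin n → Fin n) A
    (fun G : CongestedClique.SparseChain C n m => CongestedClique.neighbourInput G.1) _
    (fun G _ => proxy G) fun v G G' h₁ h₂ => (hA v G G' h₁ h₂).1
  have : Nonempty (Fin m → Fin n → ReduceDegree.NodeRecord n) :=
    ⟨fun _ j => ReduceDegree.nodeRecord R s ⊥ j⟩
  obtain ⟨f₂, hf₂⟩ := CongestedClique.exists_localOutput
    (α := Fin m → Fin n → ReduceDegree.NodeRecord n) A
    (fun G : CongestedClique.SparseChain C n m => CongestedClique.neighbourInput G.1) _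
    -- A node that is not the proxy outputs the record for the empty graph, as a value independent
    -- of the input.
    (fun G v i j => if proxy G i j = v then ReduceDegree.nodeRecord R s (G.1 i) j
      else ReduceDegree.nodeRecord R s ⊥ j) fun v G G' h₁ h₂ => by
      obtain ⟨h₃, h₄, -⟩ := hA v G G' h₁ h₂
      funext i j
      rw [← h₃]
      split_ifs with hv
      · exact h₄ i j hv
      · rfl
  have : Nonempty (Fin m → ReduceDegree.CoordinatorRecord n) :=
    ⟨fun _ => ReduceDegree.coordinatorRecord R s ⊥⟩
  obtain ⟨f₃, hf₃⟩ := CongestedClique.exists_localOutput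
    (α := Fin m → ReduceDegree.CoordinatorRecord n) A
    (fun G : CongestedClique.SparseChain C n m => CongestedClique.neighbourInput G.1) _
    (fun G v i => if Fin.castLE hmn i = v then ReduceDegree.coordinatorRecord R s (G.1 i)
      else ReduceDegree.coordinatorRecord R s ⊥) fun v G G' h₁ h₂ => by
      funext i
      split_ifs with hv
      · exact (hA v G G' h₁ h₂).2.2 i hv
      · rfl
  refine ⟨A, Fin.castLE hmn, f₁, f₂, f₃, Fin.castLE_injective hmn, fun G hG hC => ?_⟩
  refine ⟨proxy ⟨G, hG, hC⟩, hcard _, hf₁ ⟨G, hG, hC⟩, fun i j => ?_, fun i => ?_⟩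
  · exact (congrFun (congrFun (hf₂ ⟨G, hG, hC⟩ _) i) j).trans (if_pos rfl)
  · exact (congrFun (hf₃ ⟨G, hG, hC⟩ _) i).trans (if_pos rfl)
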